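/- Let $n\ge 1$ be an integer and $c\ge 0$, $\rho>0$ real numbers. Let $K=B_1(0)\times\mathbb R\times\mathbb C^n$, where $B_1(0)\subset\mathbb C^{n-1}$ is the open unit ball, with coordinates $(X^a,\tilde\phi,w^0,w^a)$, $a=1,\dots,n-1$ (for $n=1$ the families $X^a,w^a$ are empty), and let $\bar N=(0,\infty)\times K$ carry the metric $f\,\mathrm d\rho^2+g_\rho^c$, where $f(\rho)=\frac{1}{4\rho^2}\frac{\rho+2c}{\rho+c}$ and $$\begin{aligned}g_\rho^c&=\frac{\rho+c}{\rho}\frac{1}{1-\|X\|^2}\Big(\sum_{a}|\mathrm dX^a|^2+\frac{1}{1-\|X\|^2}\Big|\sum_a\bar X^a\mathrm dX^a\Big|^2\Big)\\&\quad+\frac{1}{4\rho^2}\frac{\rho+c}{\rho+2c}\Big(\mathrm d\tilde\phi-4\,\mathrm{Im}\Big(\bar w^0\mathrm dw^0-\sum_a\bar w^a\mathrm dw^a\Big)+\frac{2c}{1-\|X\|^2}\mathrm{Im}\sum_a\bar X^a\mathrm dX^a\Big)^2\\&\quad-\frac{2}{\rho}\Big(|\mathrm dw^0|^2-\sum_a|\mathrm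 dw^a|^2\Big)+\frac{\rho+c}{\rho^2}\frac{4}{1-\|X\|^2}\Big|\mathrm dw^0+\sum_aX^a\mathrm dw^a\Big|^2.\end{aligned}$$ Let $\bar N_\rho=\{\rho\}\times K$ with the induced metric $g_\rho^c$, let $p_\rho=(\rho,0)$, and use the real coordinates $(b^a,t^a,\tilde\phi,\tilde\zeta_0,\zeta^0,\tilde\zeta_a,\zeta^a)$ on $K$ given by $X^a=\frac12(b^a+it^a)$, $w^0=\frac12(\tilde\zeta_0+i\zeta^0)$, $w^a=\frac12(\tilde\zeta_a-i\zeta^a)$. Let $A_\rho$ be the endomorphism $v\mapsto\nabla_v\partial_\rho$ of $T_{p_\rho}\bar N_\rho$, where $\nabla$ is the Levi-Civita connection of $\bar N$; in these coordinates it is represented by $$A_\rho=-\frac{1}{2\rho}\,\mathrm{diag}\Big(\frac{c}{\rho+c}\mathbb 1_{2n-2},\ \frac{2\rho^2+5c\rho+4c^2}{(\rho+c)(\rho+2c)},\ \frac{\rho+4c}{\rho+2c}\mathbb 1_2,\ \mathbb 1_{2n-2}\Big).$$ Then the Ricci tensor of $(\bar N_\rho,g_\rho^c)$ at $p_\rho$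 is $$\mathrm{Ric}_{\bar N_\rho}=-2(n+2)\,g_\rho^c-2n\rho\,\partial_\rho g_\rho^c+\frac1f\,g_\rho^c(\partial_\rho A_\rho\,\cdot,\cdot),$$ and in the above real coordinates the Ricci endomorphism at $p_\rho$ is represented by the diagonal matrix $$\mathrm{ric}_{\bar N_\rho}=\mathrm{diag}\big(r_1\mathbb 1_{2n-2},\ r_2,\ r_3\mathbb 1_2,\ r_4\mathbb 1_{2n-2}\big)$$ (for $n=1$ this is $\mathrm{diag}(r_2,r_3\mathbb 1_2)$), where $$\begin{aligned}r_1&=\frac{-2(n+2)\rho^2-4(n+2)c\rho-6c^2}{(\rho+c)(\rho+2c)},\\ r_2&=\frac{2n\rho^4+(12n-8)c\rho^3+(28n-26)c^2\rho^2+32(n-1)c^3\rho+16(n-1)c^4}{(\rho+c)(\rho+2c)^3},\\ r_3&=2\,\frac{-\rho^3+(2n-3)c\rho^2+(8n-8)c^2\rho+(8n-8)c^3}{(\rho+2c)^3},\\ r_4&=-\frac{2(\rho+3c)}{\rho+2c}.\end{aligned}$$ In particular, its characteristic polynomial in $t$ is $(t-r_1)^{2n-2}(t-r_2)(t-r_3)^2(t-r_4)^{2n-2}$;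 that is, the principal Ricci curvatures $r_1,r_2,r_3,r_4$ occur with multiplicities $2n-2,\,1,\,2,\,2n-2$ (added up where values coincide). -/

import Mathlib

open scoped Matrix ComplexConjugate

noncomputable section

namespace ChartRiemann

/-! Local Riemannian geometry in a global chart with coordinates indexed by a finite type `ι`.
A metric is given by its Gram matrix `G x i j = g_x (∂_i, ∂_j)`. -/

variable {ι : Type*} [Fintype ι] [DecidableEq ι]

/-- The partial derivative `∂_i F` at `x`. -/
def pderiv (i : ι) (F : (ι → ℝ) → ℝ) (x : ι → ℝ) : ℝ :=
  fderiv ℝ F x (Pi.single i 1)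

/-- The Christoffel symbol `Γ^k_{ij}` of the Levi-Civita connection, `∇_{∂_i} ∂_j = ∑ k, Γ^k_{ij} ∂_k`. -/
def christoffel (G : (ι → ℝ) → Matrix ι ι ℝ) (k i j : ι) (x : ι → ℝ) : ℝ :=
  (1 / 2) * ∑ l, (G x)⁻¹ k l *
    (pderiv i (fun y => G y j l) x + pderiv j (fun y => G y i l) x - pderiv l (fun y => G y i j) x)

/-- The coefficient of `∂_l` in `R(∂_i, ∂_j) ∂_k`, where
`R(X, Y) Z = ∇_X ∇_Y Z - ∇_Y ∇_X Z - ∇_{[X, Y]} Z`. -/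
def riemann (G : (ι → ℝ) → Matrix ι ι ℝ) (l i j k : ι) (x : ι → ℝ) : ℝ :=
  pderiv i (christoffel G l j k) x - pderiv j (christoffel G l i k) x
    + ∑ p, (christoffel G l i p x * christoffel G p j k x
      - christoffel G l j p x * christoffel G p i k x)

/-- The components of the Ricci tensor, `Ric(Y, Z) = tr (V ↦ R(V, Y) Z)`. -/
def ricciMatrix (G : (ι → ℝ) → Matrix ι ι ℝ) (x : ι → ℝ) : Matrix ι ι ℝ :=
  Matrix.of fun j k => ∑ i, riemann G i i j k x

/-- The Ricci tensor at `x`, as a bilinear form. -/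
def ricciTensor (G : (ι → ℝ) → Matrix ι ι ℝ) (x u v : ι → ℝ) : ℝ :=
  u ⬝ᵥ (ricciMatrix G x *ᵥ v)

/-- The matrix of the Ricci endomorphism `ric` at `x`, determined by `Ric(u, v) = g(u, ric v)`. -/
def ricciEndo (G : (ι → ℝ) → Matrix ι ι ℝ) (x : ι → ℝ) : Matrix ι ι ℝ :=
  (G x)⁻¹ * ricciMatrix G x

end ChartRiemann

namespace OneLoop

/-- Indices of the real coordinates `(b^a, t^a, φ, ζ'_0, ζ^0, ζ'_a, ζ^a)`, `1 ≤ a ≤ n - 1`, in this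
order, where `φ` and `ζ'` stand for the coordinates usually written with a tilde. -/
abbrev Coord (n : ℕ) : Type :=
  (Fin (n - 1) ⊕ Fin (n - 1)) ⊕ (Fin 3 ⊕ (Fin (n - 1) ⊕ Fin (n - 1)))

variable {n : ℕ}

/-- The complex coordinate `X^a = (b^a + i t^a) / 2`. All the coordinates here are real-linear, so that
the same functions, applied to a tangent vector, are the differentials `dX^a`, `dφ`, `dw^0`, `dw^a`. -/
def cX (x : Coord n → ℝ) (a : Fin (n - 1)) : ℂ :=
  (1 / 2) * ((x (.inl (.inl a)) : ℂ) + Complex.I * (x (.inl (.inr a)) : ℂ))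

/-- The real coordinate `φ`. -/
def cPhi (x : Coord n → ℝ) : ℝ := x (.inr (.inl 0))

/-- The complex coordinate `w^0 = (ζ'_0 + i ζ^0) / 2`. -/
def cW0 (x : Coord n → ℝ) : ℂ :=
  (1 / 2) * ((x (.inr (.inl 1)) : ℂ) + Complex.I * (x (.inr (.inl 2)) : ℂ))

/-- The complex coordinate `w^a = (ζ'_a - i ζ^a) / 2`. -/
def cW (x : Coord n → ℝ) (a : Fin (n - 1)) : ℂ :=
  (1 / 2) * ((x (.inr (.inr (.inl a))) : ℂ) - Complex.I * (x (.inr (.inr (.inr a))) : ℂ))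

/-- The real symmetric product on `ℂ` with `herm z z = |z| ^ 2`. -/
def herm (z w : ℂ) : ℝ := (z * conj w).re

/-- `1 - ‖X‖²`, which is positive on the coordinate domain `K = B_1(0) × ℝ × ℂ^n`. -/
def gap (x : Coord n → ℝ) : ℝ := 1 - ∑ a, Complex.normSq (cX x a)

/-- The complex one-form `∑ a, conj (X^a) dX^a` at `x`. -/
def formXdX (x u : Coord n → ℝ) : ℂ := ∑ a, conj (cX x a) * cX u a

/-- The real one-form
`dφ - 4 Im (conj w^0 dw^0 - ∑ conj w^a dw^a) + 2c / (1 - ‖X‖²) Im (∑ conj X^a dX^a)` at `x`. -/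
def formPhi (c : ℝ) (x u : Coord n → ℝ) : ℝ :=
  cPhi u - 4 * (conj (cW0 x) * cW0 u - ∑ a, conj (cW x a) * cW u a).im
    + 2 * c / gap x * (formXdX x u).im

/-- The complex one-form `dw^0 + ∑ X^a dw^a` at `x`. -/
def formW (x u : Coord n → ℝ) : ℂ := cW0 u + ∑ a, cX x a * cW u a

/-- The metric `g_ρ^c` of the hypersurface at the point `(ρ, x)`, evaluated on the tangent vectors
`u` and `v`; squares of one-forms are polarized. -/
def fiberMetric (c ρ : ℝ) (x u v : Coord n → ℝ) : ℝ :=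
  (ρ + c) / ρ * (1 / gap x) *
      (∑ a, herm (cX u a) (cX v a) + 1 / gap x * herm (formXdX x u) (formXdX x v))
    + 1 / (4 * ρ ^ 2) * ((ρ + c) / (ρ + 2 * c)) * (formPhi c x u * formPhi c x v)
    - 2 / ρ * (herm (cW0 u) (cW0 v) - ∑ a, herm (cW u a) (cW v a))
    + (ρ + c) / ρ ^ 2 * (4 / gap x) * herm (formW x u) (formW x v)

variable (n) in
/-- The Gram matrix of `g_ρ^c` in the real coordinates. -/
def fiberGram (c ρ : ℝ) (x : Coord n → ℝ) : Matrix (Coord n) (Coord n) ℝ :=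
  Matrix.of fun i j => fiberMetric c ρ x (Pi.single i 1) (Pi.single j 1)

/-- The coefficient `f(ρ)` of `dρ²`. -/
def lapse (c ρ : ℝ) : ℝ := 1 / (4 * ρ ^ 2) * ((ρ + 2 * c) / (ρ + c))

variable (n) in
/-- The Gram matrix of the ambient metric `f(ρ) dρ² + g_ρ^c` on `(0, ∞) × K`; the coordinate `ρ` has
the index `Sum.inl ()`. -/
def ambientGram (c : ℝ) (y : Unit ⊕ Coord n → ℝ) : Matrix (Unit ⊕ Coord n) (Unit ⊕ Coord n) ℝ :=
  Matrix.fromBlocks (Matrix.of fun _ _ => lapse c (y (.inl ()))) 0 0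
    (fiberGram n c (y (.inl ())) fun i => y (.inr i))

variable (n) in
/-- The matrix of the endomorphism `A_ρ : v ↦ ∇_v ∂_ρ` of the tangent space of the hypersurface at
`p_ρ = (ρ, 0)`, where `∇` is the Levi-Civita connection of the ambient metric. -/
def shapeA (c ρ : ℝ) : Matrix (Coord n) (Coord n) ℝ :=
  Matrix.of fun k i => ChartRiemann.christoffel (ambientGram n c) (.inr k) (.inr i) (.inl ())
    (Sum.elim (fun _ => ρ) 0)

variable (n) in
/-- The entrywise derivative `∂_ρ A_ρ`. -/
def shapeADeriv (c ρ : ℝ) : Matrix (Coord n) (Coord n) ℝ :=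
  Matrix.of fun k i => deriv (fun r => shapeA n c r k i) ρ

variable (n) in
/-- The vector with the entries `a₁` (`2n - 2` times), `a₂` (once), `a₃` (twice) and `a₄`
(`2n - 2` times), in the order of the coordinates. -/
def blockVec (a₁ a₂ a₃ a₄ : ℝ) : Coord n → ℝ :=
  Sum.elim (fun _ => a₁) (Sum.elim ![a₂, a₃, a₃] (fun _ => a₄))

/-- The principal Ricci curvature `r₁`. -/
def r₁ (n : ℕ) (c ρ : ℝ) : ℝ :=
  (-2 * (n + 2) * ρ ^ 2 - 4 * (n + 2) * c * ρ - 6 * c ^ 2) / ((ρ + c) * (ρ + 2 * c))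

/-- The principal Ricci curvature `r₂`. -/
def r₂ (n : ℕ) (c ρ : ℝ) : ℝ :=
  (2 * n * ρ ^ 4 + (12 * n - 8) * c * ρ ^ 3 + (28 * n - 26) * c ^ 2 * ρ ^ 2
    + 32 * (n - 1) * c ^ 3 * ρ + 16 * (n - 1) * c ^ 4) / ((ρ + c) * (ρ + 2 * c) ^ 3)

/-- The principal Ricci curvature `r₃`. -/
def r₃ (n : ℕ) (c ρ : ℝ) : ℝ :=
  2 * ((-ρ ^ 3 + (2 * n - 3) * c * ρ ^ 2 + (8 * n - 8) * c ^ 2 * ρ + (8 * n - 8) * c ^ 3)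
    / (ρ + 2 * c) ^ 3)

/-- The principal Ricci curvature `r₄`. -/
def r₄ (c ρ : ℝ) : ℝ := -(2 * (ρ + 3 * c) / (ρ + 2 * c))

end OneLoop

end

open ChartRiemann OneLoop

/-!
The two-jet of the metric at `0` determines its Ricci tensor there, and the Gram matrix at `0`
is diagonal. In coordinates in which `g_{ij} = δ_{ij} d_i` at a point, with lowered Christoffel
symbols `Γ_{p,ij} = (∂_i g_{jp} + ∂_j g_{ip} - ∂_p g_{ij}) / 2`, the Ricci tensor is
(`ricciMatrix_eq_of_jet`)

  `Ric_{jk} = ∑ i, (∂_i ∂_k g_{ij} + ∂_i ∂_j g_{ik} - ∂_i ∂_i g_{jk} - ∂_j ∂_k g_{ii}) / (2 d_i)`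
  `  - ∑ i p, (Γ_{p,ii} Γ_{p,jk} - Γ_{p,ij} Γ_{p,ik}) / (d_i d_p)`.

Apart from the factor `1 / (1 - ‖X‖²)`, whose two-jet at `0` is `1 + ‖X‖²`, the metric is a
polynomial in one-forms that are affine in the base point, so a product rule for two-jets gives
its derivatives (`hasJet2_fiberMetric`). All `Γ_{p,ii}` vanish at `0`.

The maps `X^a ↦ ±X^a`, `w^0 ↦ ±w^0`, `w^a ↦ ±w^a` with compatible signs, and the complex
conjugation of all of these together with `φ ↦ -φ`, are isometries that fix the origin and
multiply the coordinates by signs. Any two coordinates are told apart by one of them, hence the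
Ricci tensor is diagonal at the origin (`ricciSum_of_ne`). The diagonal entries are evaluated in
`ricciSum_self`.

The endomorphism `A_ρ` is half the logarithmic derivative of the diagonal Gram matrix with
respect to `ρ`, because the ambient metric is block diagonal and `∂_ρ` has constant length along
the hypersurfaces (`shapeA_eq`). So all the tensors in the formula for the Ricci tensor are
diagonal at the origin, and it reduces to the identity
`∂_ρ A_i = f (r_i + 2 (n + 2) + 4 n ρ A_i)` between rational functions of `ρ`
(`hasDerivAt_shapeDiag`).
-/

open ChartRiemann OneLoop

namespace ChartRiemann

/-! ### Two-jets of real functions -/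

/-- `HasJet2 f x₀ a D H`: the function `f` is `C²` at `x₀`, with value `a`, first differential
`D` and second differential `H` there. The differentials are recorded as plain functions of the
directions. -/
structure HasJet2 {E : Type*} [NormedAddCommGroup E] [NormedSpace ℝ E]
    (f : E → ℝ) (x₀ : E) (a : ℝ) (D : E → ℝ) (H : E → E → ℝ) : Prop where
  contDiffAt : ContDiffAt ℝ 2 f x₀
  value : f x₀ = a
  first : ∀ v, fderiv ℝ f x₀ v = D v
  second : ∀ v w, fderiv ℝ (fun x => fderiv ℝ f x w) x₀ v = H v w

section Jets

variable {E : Type*} [NormedAddCommGroup E] [NormedSpace ℝ E] {f g : E → ℝ} {x₀ : E} {a b : ℝ}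
  {D D' : E → ℝ} {H H' : E → E → ℝ}

theorem eventually_differentiableAt_of_contDiffAt (h : ContDiffAt ℝ 2 f x₀) :
    ∀ᶠ x in nhds x₀, DifferentiableAt ℝ f x := by
  filter_upwards [h.eventually (by simp)] with x hx
  exact hx.differentiableAt (by norm_num)

theorem differentiableAt_fderiv_apply (h : ContDiffAt ℝ 2 f x₀) (w : E) :
    DifferentiableAt ℝ (fun x => fderiv ℝ f x w) x₀ :=
  ((h.fderiv_right (m := 1) (by norm_num)).differentiableAt (by norm_num)).clm_apply
    (differentiableAt_const w)

theorem HasJet2.differentiableAt (h : HasJet2 f x₀ a D H) : DifferentiableAt ℝ f x₀ :=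
  h.contDiffAt.differentiableAt (by norm_num)

theorem HasJet2.congr_jet (h : HasJet2 f x₀ a D H) (ha : a = b) (hD : ∀ v, D v = D' v)
    (hH : ∀ v w, H v w = H' v w) : HasJet2 f x₀ b D' H' :=
  ⟨h.contDiffAt, h.value.trans ha, fun v => (h.first v).trans (hD v),
    fun v w => (h.second v w).trans (hH v w)⟩

theorem HasJet2.congr_fun (h : HasJet2 f x₀ a D H) (hg : ∀ x, g x = f x) :
    HasJet2 g x₀ a D H := by
  rwa [funext hg]

theorem HasJet2.const (a : ℝ) (x₀ : E) :
    HasJet2 (fun _ : E => a) x₀ a (fun _ => 0) (fun _ _ => 0) :=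
  ⟨contDiffAt_const, rfl, fun v => by simp, fun v w => by simp⟩

theorem HasJet2.clm (l : E →L[ℝ] ℝ) (x₀ : E) :
    HasJet2 (fun x => l x) x₀ (l x₀) (fun v => l v) (fun _ _ => 0) :=
  ⟨l.contDiff.contDiffAt, rfl, fun v => by simp, fun v w => by simp⟩

theorem HasJet2.add (hf : HasJet2 f x₀ a D H) (hg : HasJet2 g x₀ b D' H') :
    HasJet2 (fun x => f x + g x) x₀ (a + b) (fun v => D v + D' v) (fun v w => H v w + H' v w) := by
  refine ⟨hf.contDiffAt.add hg.contDiffAt, by rw [hf.value, hg.value], fun v => ?_, fun v w => ?_⟩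
  · rw [fderiv_fun_add hf.differentiableAt hg.differentiableAt, add_apply, hf.first, hg.first]
  · have key : (fun x => fderiv ℝ (fun x => f x + g x) x w) =ᶠ[nhds x₀]
        fun x => fderiv ℝ f x w + fderiv ℝ g x w := by
      filter_upwards [eventually_differentiableAt_of_contDiffAt hf.contDiffAt,
        eventually_differentiableAt_of_contDiffAt hg.contDiffAt] with x h1 h2
      rw [fderiv_fun_add h1 h2, add_apply]
    rw [key.fderiv_eq, fderiv_fun_add (differentiableAt_fderiv_apply hf.contDiffAt w)
      (differentiableAt_fderiv_apply hg.contDiffAt w), add_apply, hf.second, hg.second]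

theorem HasJet2.mul (hf : HasJet2 f x₀ a D H) (hg : HasJet2 g x₀ b D' H') :
    HasJet2 (fun x => f x * g x) x₀ (a * b) (fun v => a * D' v + b * D v)
      (fun v w => a * H' v w + D v * D' w + b * H v w + D' v * D w) := by
  refine ⟨hf.contDiffAt.mul hg.contDiffAt, by rw [hf.value, hg.value], fun v => ?_, fun v w => ?_⟩
  · rw [fderiv_fun_mul hf.differentiableAt hg.differentiableAt]
    simp [hf.first, hg.first, hf.value, hg.value]
  · have key : (fun x => fderiv ℝ (fun x => f x * g x) x w) =ᶠ[nhds x₀]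
        fun x => f x * fderiv ℝ g x w + g x * fderiv ℝ f x w := by
      filter_upwards [eventually_differentiableAt_of_contDiffAt hf.contDiffAt,
        eventually_differentiableAt_of_contDiffAt hg.contDiffAt] with x h1 h2
      rw [fderiv_fun_mul h1 h2]
      simp
    have hf' := differentiableAt_fderiv_apply hf.contDiffAt w
    have hg' := differentiableAt_fderiv_apply hg.contDiffAt w
    rw [key.fderiv_eq, fderiv_fun_add (hf.differentiableAt.fun_mul hg')
      (hg.differentiableAt.fun_mul hf'), fderiv_fun_mul hf.differentiableAt hg',
      fderiv_fun_mul hg.differentiableAt hf']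
    simp only [add_apply, smul_apply, smul_eq_mul, hf.first, hg.first, hf.value, hg.value,
      hf.second, hg.second]
    ring

theorem HasJet2.const_mul (hf : HasJet2 f x₀ a D H) (k : ℝ) :
    HasJet2 (fun x => k * f x) x₀ (k * a) (fun v => k * D v) (fun v w => k * H v w) :=
  ((HasJet2.const k x₀).mul hf).congr_jet rfl (by simp) (by simp)

theorem HasJet2.inv (hf : HasJet2 f x₀ a D H) (ha : a ≠ 0) :
    HasJet2 (fun x => (f x)⁻¹) x₀ a⁻¹ (fun v => -D v / a ^ 2)
      (fun v w => -H v w / a ^ 2 + 2 * D v * D w / a ^ 3) := by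
  have hne : f x₀ ≠ 0 := by rwa [hf.value]
  have hd : ∀ x, DifferentiableAt ℝ f x → f x ≠ 0 → ∀ w,
      fderiv ℝ (fun x => (f x)⁻¹) x w = -((f x)⁻¹ * (f x)⁻¹) * fderiv ℝ f x w := by
    intro x hx h0 w
    have h : HasFDerivAt (fun x => (f x)⁻¹) (-(f x ^ 2)⁻¹ • fderiv ℝ f x) x :=
      (hasDerivAt_inv h0).comp_hasFDerivAt x hx.hasFDerivAt
    rw [h.fderiv]
    simp [sq]
  refine ⟨hf.contDiffAt.inv hne, by rw [hf.value], fun v => ?_, fun v w => ?_⟩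
  · rw [hd _ hf.differentiableAt hne, hf.first, hf.value]
    field_simp
  · have key : (fun x => fderiv ℝ (fun x => (f x)⁻¹) x w) =ᶠ[nhds x₀]
        fun x => -((f x)⁻¹ * (f x)⁻¹) * fderiv ℝ f x w := by
      filter_upwards [eventually_differentiableAt_of_contDiffAt hf.contDiffAt,
        hf.contDiffAt.continuousAt.eventually_ne hne] with x h1 h2
      exact hd x h1 h2 w
    have hf' := differentiableAt_fderiv_apply hf.contDiffAt w
    have hi : DifferentiableAt ℝ (fun x => (f x)⁻¹) x₀ := hf.differentiableAt.fun_inv hne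
    rw [key.fderiv_eq, fderiv_fun_mul (hi.fun_mul hi).fun_neg hf', fderiv_fun_neg,
      fderiv_fun_mul hi hi]
    simp only [add_apply, smul_apply, neg_apply, smul_eq_mul,
      hd _ hf.differentiableAt hne, hf.first, hf.value, hf.second]
    field_simp
    ring

theorem HasJet2.sum {κ : Type*} (s : Finset κ) {f : κ → E → ℝ} {x₀ : E} {a : κ → ℝ}
    {D : κ → E → ℝ} {H : κ → E → E → ℝ} (h : ∀ i, HasJet2 (f i) x₀ (a i) (D i) (H i)) :
    HasJet2 (fun x => ∑ i ∈ s, f i x) x₀ (∑ i ∈ s, a i) (fun v => ∑ i ∈ s, D i v)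
      (fun v w => ∑ i ∈ s, H i v w) := by
  classical
  induction s using Finset.induction_on with
  | empty => simpa using HasJet2.const 0 x₀
  | insert i s hi ih => simpa [Finset.sum_insert hi] using (h i).add ih

theorem HasJet2.of_linear [FiniteDimensional ℝ E] (f : E → ℝ)
    (hadd : ∀ x y, f (x + y) = f x + f y) (hsmul : ∀ (k : ℝ) x, f (k • x) = k * f x) :
    HasJet2 f 0 0 f (fun _ _ => 0) := by
  let l : E →ₗ[ℝ] ℝ := { toFun := f, map_add' := hadd, map_smul' := hsmul }
  have h := HasJet2.clm (LinearMap.toContinuousLinearMap l) (0 : E)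
  exact h.congr_jet (map_zero _) (fun v => rfl) (fun v w => rfl)

end Jets

/-! ### The Ricci tensor at a point where the Gram matrix is diagonal -/

section Ricci

variable {ι : Type*} [Fintype ι] [DecidableEq ι]

theorem inv_diagonal_of_ne_zero {d : ι → ℝ} (hd : ∀ i, d i ≠ 0) :
    (Matrix.diagonal d)⁻¹ = Matrix.diagonal fun i => (d i)⁻¹ := by
  apply Matrix.inv_eq_right_inv
  rw [Matrix.diagonal_mul_diagonal, ← Matrix.diagonal_one]
  congr 1
  ext i
  exact mul_inv_cancel₀ (hd i)

theorem differentiableAt_det {E : Type*} [NormedAddCommGroup E] [NormedSpace ℝ E]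
    {G : E → Matrix ι ι ℝ} {x₀ : E} (hG : ∀ i j, DifferentiableAt ℝ (fun x => G x i j) x₀) :
    DifferentiableAt ℝ (fun x => (G x).det) x₀ := by
  simp only [Matrix.det_apply]
  refine DifferentiableAt.fun_sum fun s _ => DifferentiableAt.fun_const_smul ?_ _
  exact (HasFDerivAt.finsetProd fun i _ => (hG (s i) i).hasFDerivAt).differentiableAt

theorem differentiableAt_inv_apply {E : Type*} [NormedAddCommGroup E] [NormedSpace ℝ E]
    {G : E → Matrix ι ι ℝ} {x₀ : E} (hG : ∀ i j, DifferentiableAt ℝ (fun x => G x i j) x₀)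
    (hdet : (G x₀).det ≠ 0) (k l : ι) : DifferentiableAt ℝ (fun x => (G x)⁻¹ k l) x₀ := by
  simp only [Matrix.inv_def, Matrix.smul_apply, Matrix.adjugate_apply, Ring.inverse_eq_inv',
    smul_eq_mul]
  refine ((differentiableAt_det hG).fun_inv hdet).fun_mul (differentiableAt_det fun i j => ?_)
  simp only [Matrix.updateRow_apply]
  split_ifs
  · exact differentiableAt_const _
  · exact hG i j

/-- Differentiation of the inverse matrix: `∂(G⁻¹) = -G⁻¹ (∂G) G⁻¹`, where `G` is diagonal. -/
theorem fderiv_inv_apply {E : Type*} [NormedAddCommGroup E] [NormedSpace ℝ E]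
    {G : E → Matrix ι ι ℝ} {x₀ : E} {d : ι → ℝ}
    (hG : ∀ i j, DifferentiableAt ℝ (fun x => G x i j) x₀) (h0 : G x₀ = Matrix.diagonal d)
    (hd : ∀ i, d i ≠ 0) (k l : ι) (v : E) : fderiv ℝ (fun x => (G x)⁻¹ k l) x₀ v =
      -((d k)⁻¹ * fderiv ℝ (fun x => G x k l) x₀ v * (d l)⁻¹) := by
  have hdet : (G x₀).det ≠ 0 := by
    rw [h0, Matrix.det_diagonal]
    exact Finset.prod_ne_zero_iff.2 fun i _ => hd i
  have hi := differentiableAt_inv_apply hG hdet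
  have hinv : ∀ k l, (G x₀)⁻¹ k l = if k = l then (d k)⁻¹ else 0 := by
    intro k l
    rw [h0, inv_diagonal_of_ne_zero hd, Matrix.diagonal_apply]
  -- The rule follows by differentiating `G⁻¹ * G = 1`.
  have key : (fun x => ∑ m, (G x)⁻¹ k m * G x m l) =ᶠ[nhds x₀]
      fun _ => (1 : Matrix ι ι ℝ) k l := by
    filter_upwards [(differentiableAt_det hG).continuousAt.eventually_ne hdet] with x hx
    rw [← Matrix.mul_apply, Matrix.nonsing_inv_mul _ (isUnit_iff_ne_zero.2 hx)]
  have h := congrArg (fun L : E →L[ℝ] ℝ => L v) key.fderiv_eq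
  rw [fderiv_fun_sum fun m _ => (hi k m).fun_mul (hG m l)] at h
  simp only [sum_apply, fderiv_fun_mul (hi k _) (hG _ l), add_apply, smul_apply, hinv,
    smul_eq_mul, Finset.sum_add_distrib, ite_mul, zero_mul, Finset.sum_ite_eq,
    Finset.mem_univ, if_true, fderiv_fun_const, Pi.zero_apply, zero_apply] at h
  simp only [h0, Matrix.diagonal_apply, ite_mul, zero_mul, Finset.sum_ite_eq', Finset.mem_univ,
    if_true] at h
  have := hd k
  have := hd l
  field_simp at h ⊢
  linarith

/-- The Christoffel symbol of the first kind, `g(∇_{∂_i} ∂_j, ∂_l)`, as an expression in the first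
derivatives `D k i j = ∂_k g_{ij}`. -/
noncomputable def lowerChristoffel (D : ι → ι → ι → ℝ) (l i j : ι) : ℝ :=
  (1 / 2) * (D i j l + D j i l - D l i j)

/-- The Ricci tensor at a point where the Gram matrix is diagonal. In terms of the lowered
symbols the derivatives of the inverse matrix combine with the quadratic terms of the curvature,
since `∂_k g_{ij} = Γ_{i,kj} + Γ_{j,ki}`. -/
theorem ricciMatrix_eq_of_jet {G : (ι → ℝ) → Matrix ι ι ℝ} {x₀ : ι → ℝ} {d : ι → ℝ}
    {D : ι → ι → ι → ℝ} {H : ι → ι → ι → ι → ℝ}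
    (hG : ∀ i j, ContDiffAt ℝ 2 (fun x => G x i j) x₀) (h0 : G x₀ = Matrix.diagonal d)
    (hd : ∀ i, d i ≠ 0)
    (hD : ∀ k i j, pderiv k (fun x => G x i j) x₀ = D k i j)
    (hH : ∀ k l i j, pderiv k (pderiv l fun x => G x i j) x₀ = H k l i j)
    (hDs : ∀ k i j, D k i j = D k j i) (hHs : ∀ k l i j, H k l i j = H l k i j)
    (hHs' : ∀ k l i j, H k l i j = H k l j i) (j k : ι) :
    ricciMatrix G x₀ j k =
      (∑ i, (d i)⁻¹ / 2 * (H i k i j + H i j i k - H i i j k - H j k i i))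
        - ∑ i, ∑ p, (d i)⁻¹ * (d p)⁻¹ *
          (lowerChristoffel D p i i * lowerChristoffel D p j k
            - lowerChristoffel D p i j * lowerChristoffel D p i k) := by
  have hG' := fun i j => (hG i j).differentiableAt (by norm_num)
  have hdet : (G x₀).det ≠ 0 := by
    rw [h0, Matrix.det_diagonal]
    exact Finset.prod_ne_zero_iff.2 fun i _ => hd i
  have hinv : ∀ k l, (G x₀)⁻¹ k l = if k = l then (d k)⁻¹ else 0 := by
    intro k l
    rw [h0, inv_diagonal_of_ne_zero hd, Matrix.diagonal_apply]
  have hch : ∀ l i j, christoffel G l i j x₀ = (d l)⁻¹ * lowerChristoffel D l i j := by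
    intro l i j
    simp only [christoffel, hD, hinv, lowerChristoffel]
    simp
    ring
  have hdiff : ∀ l i j, DifferentiableAt ℝ (pderiv l fun x => G x i j) x₀ := fun l i j =>
    differentiableAt_fderiv_apply (hG i j) _
  have hdch : ∀ i l j k, pderiv i (christoffel G l j k) x₀ =
      (d l)⁻¹ * ((1 / 2) * (H i j k l + H i k j l - H i l j k)
        - ∑ m, D i l m * (d m)⁻¹ * lowerChristoffel D m j k) := by
    intro i l j k
    have hi : ∀ m, DifferentiableAt ℝ (fun x => (G x)⁻¹ l m) x₀ := fun m =>
      differentiableAt_inv_apply hG' hdet l m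
    have hT : ∀ m, DifferentiableAt ℝ (fun x => pderiv j (fun y => G y k m) x
        + pderiv k (fun y => G y j m) x - pderiv m (fun y => G y j k) x) x₀ := fun m =>
      ((hdiff j k m).fun_add (hdiff k j m)).fun_sub (hdiff m j k)
    have hT' : ∀ m, fderiv ℝ (fun x => pderiv j (fun y => G y k m) x
        + pderiv k (fun y => G y j m) x - pderiv m (fun y => G y j k) x) x₀ (Pi.single i 1) =
        H i j k m + H i k j m - H i m j k := by
      intro m
      rw [fderiv_fun_sub ((hdiff j k m).fun_add (hdiff k j m)) (hdiff m j k),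
        fderiv_fun_add (hdiff j k m) (hdiff k j m), sub_apply, add_apply, ← hH, ← hH, ← hH]
      rfl
    unfold pderiv
    unfold christoffel
    rw [fderiv_const_mul (DifferentiableAt.fun_sum fun m _ => (hi m).fun_mul (hT m)),
      fderiv_fun_sum fun m _ => (hi m).fun_mul (hT m)]
    simp only [smul_apply, sum_apply, smul_eq_mul]
    have : ∀ m, fderiv ℝ (fun x => (G x)⁻¹ l m * (pderiv j (fun y => G y k m) x
        + pderiv k (fun y => G y j m) x - pderiv m (fun y => G y j k) x)) x₀ (Pi.single i 1) =
        (if l = m then (d l)⁻¹ else 0) * (H i j k m + H i k j m - H i m j k)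
          - (d l)⁻¹ * D i l m * (d m)⁻¹ * (2 * lowerChristoffel D m j k) := by
      intro m
      rw [fderiv_fun_mul (hi m) (hT m), add_apply, smul_apply, smul_apply, hT',
        fderiv_inv_apply hG' h0 hd, hinv]
      have := hD i l m
      unfold pderiv at this
      rw [this, hD, hD, hD, lowerChristoffel, smul_eq_mul, smul_eq_mul]
      ring
    rw [Finset.sum_congr rfl fun m _ => this m]
    rw [Finset.sum_sub_distrib]
    simp only [ite_mul, zero_mul, Finset.sum_ite_eq, Finset.mem_univ, if_true]
    rw [mul_sub (1 / 2 : ℝ), mul_sub (d l)⁻¹ _ (Finset.sum _ _), Finset.mul_sum, Finset.mul_sum]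
    congr 1
    · ring
    · exact Finset.sum_congr rfl fun m _ => by ring
  simp only [ricciMatrix, Matrix.of_apply, riemann, hdch, hch]
  -- Metric compatibility, `∂_k g_{ij} = Γ_{i,kj} + Γ_{j,ki}`, for two patterns of indices.
  have split : ∀ i m, D i i m = lowerChristoffel D i i m + lowerChristoffel D m i i := by
    intro i m
    simp only [lowerChristoffel]
    rw [hDs i m i]
    ring
  have split' : ∀ i m, D j i m = lowerChristoffel D i j m + lowerChristoffel D m i j := by
    intro i m
    simp only [lowerChristoffel]
    rw [hDs m i j, hDs j m i]
    ring
  rw [← Finset.sum_sub_distrib]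
  refine Finset.sum_congr rfl fun i _ => ?_
  rw [mul_sub (d i)⁻¹, mul_sub (d i)⁻¹, Finset.mul_sum, Finset.mul_sum]
  have e1 : ∀ A B X Y S : ℝ, A - X - (B - Y) + S = (A - B) - (X - Y - S) := by intros; ring
  rw [e1, ← Finset.sum_sub_distrib, ← Finset.sum_sub_distrib]
  congr 1
  · rw [hHs i j k i, hHs' j i k i, hHs' i k j i, hHs j i i k, hHs' j k i i]
    ring
  · refine Finset.sum_congr rfl fun p _ => ?_
    rw [split, split']
    ring

end Ricci

end ChartRiemann

namespace OneLoop

/-! ### The one-forms of the metric in real coordinates -/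

variable {n : ℕ}

/-- The symmetric form `Re ∑ conj X^a dX^a`, at the base point `x` on the tangent vector `u`; as `X^a`
is linear, both arguments are coordinate vectors. -/
noncomputable def symX (x u : Coord n → ℝ) : ℝ :=
  ∑ a, (x (.inl (.inl a)) * u (.inl (.inl a)) + x (.inl (.inr a)) * u (.inl (.inr a))) / 4

/-- The alternating form `Im ∑ conj X^a dX^a`. -/
noncomputable def skewX (x u : Coord n → ℝ) : ℝ :=
  ∑ a, (x (.inl (.inl a)) * u (.inl (.inr a)) - x (.inl (.inr a)) * u (.inl (.inl a))) / 4

/-- The alternating form `-4 Im (conj w^0 dw^0 - ∑ conj w^a dw^a)`. -/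
noncomputable def skewW (x u : Coord n → ℝ) : ℝ :=
  -(x (.inr (.inl 1)) * u (.inr (.inl 2)) - x (.inr (.inl 2)) * u (.inr (.inl 1)))
    - ∑ a, (x (.inr (.inr (.inl a))) * u (.inr (.inr (.inr a)))
      - x (.inr (.inr (.inr a))) * u (.inr (.inr (.inl a))))

/-- The real part of `∑ X^a dw^a`. -/
noncomputable def reXdW (x u : Coord n → ℝ) : ℝ :=
  ∑ a, (x (.inl (.inl a)) * u (.inr (.inr (.inl a)))
    + x (.inl (.inr a)) * u (.inr (.inr (.inr a)))) / 4

/-- The imaginary part of `∑ X^a dw^a`. -/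
noncomputable def imXdW (x u : Coord n → ℝ) : ℝ :=
  ∑ a, (x (.inl (.inr a)) * u (.inr (.inr (.inl a)))
    - x (.inl (.inl a)) * u (.inr (.inr (.inr a)))) / 4

/-- The symmetric form `∑ |dw^a|²`. -/
noncomputable def symW (u v : Coord n → ℝ) : ℝ :=
  ∑ a, (u (.inr (.inr (.inl a))) * v (.inr (.inr (.inl a)))
    + u (.inr (.inr (.inr a))) * v (.inr (.inr (.inr a)))) / 4

/-- The symmetric form `|dw^0|²`. -/
noncomputable def symW0 (u v : Coord n → ℝ) : ℝ :=
  (u (.inr (.inl 1)) * v (.inr (.inl 1)) + u (.inr (.inl 2)) * v (.inr (.inl 2))) / 4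

theorem gap_eq (x : Coord n → ℝ) : gap x = 1 - symX x x := by
  simp only [gap, symX, Complex.normSq_apply, cX]
  congr 1
  refine Finset.sum_congr rfl fun a _ => ?_
  simp
  ring

theorem formXdX_re (x u : Coord n → ℝ) : (formXdX x u).re = symX x u := by
  simp only [formXdX, symX, cX, Complex.re_sum]
  refine Finset.sum_congr rfl fun a _ => ?_
  simp
  ring

theorem formXdX_im (x u : Coord n → ℝ) : (formXdX x u).im = skewX x u := by
  simp only [formXdX, skewX, cX, Complex.im_sum]
  refine Finset.sum_congr rfl fun a _ => ?_
  simp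
  ring

theorem formPhi_eq (c : ℝ) (x u : Coord n → ℝ) :
    formPhi c x u = cPhi u + skewW x u + 2 * c * (gap x)⁻¹ * skewX x u := by
  have : -4 * (conj (cW0 x) * cW0 u - ∑ a, conj (cW x a) * cW u a).im = skewW x u := by
    simp only [skewW, Complex.sub_im, Complex.im_sum, mul_sub, Finset.mul_sum]
    congr 1
    · simp [cW0]
      ring
    · refine Finset.sum_congr rfl fun a _ => ?_
      simp [cW]
      ring
  rw [formPhi, formXdX_im, ← this]
  ring

theorem formW_re (x u : Coord n → ℝ) : (formW x u).re = u (.inr (.inl 1)) / 2 + reXdW x u := by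
  simp only [formW, reXdW, cX, cW, cW0, Complex.add_re, Complex.re_sum]
  congr 1
  · simp
    ring
  · refine Finset.sum_congr rfl fun a _ => ?_
    simp
    ring

theorem formW_im (x u : Coord n → ℝ) : (formW x u).im = u (.inr (.inl 2)) / 2 + imXdW x u := by
  simp only [formW, imXdW, cX, cW, cW0, Complex.add_im, Complex.im_sum]
  congr 1
  · simp
    ring
  · refine Finset.sum_congr rfl fun a _ => ?_
    simp
    ring

theorem herm_eq (z w : ℂ) : herm z w = z.re * w.re + z.im * w.im := by
  simp [herm]

theorem fiberMetric_eq (c ρ : ℝ) (x u v : Coord n → ℝ) :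
    fiberMetric c ρ x u v =
      (ρ + c) / ρ * ((gap x)⁻¹ * (symX u v + (gap x)⁻¹
        * (symX x u * symX x v + skewX x u * skewX x v)))
      + 1 / (4 * ρ ^ 2) * ((ρ + c) / (ρ + 2 * c)) *
        ((cPhi u + skewW x u + 2 * c * ((gap x)⁻¹ * skewX x u))
          * (cPhi v + skewW x v + 2 * c * ((gap x)⁻¹ * skewX x v)))
      + -2 / ρ * (symW0 u v - symW u v)
      + 4 * (ρ + c) / ρ ^ 2 * ((gap x)⁻¹ *
        ((u (.inr (.inl 1)) / 2 + reXdW x u) * (v (.inr (.inl 1)) / 2 + reXdW x v)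
          + (u (.inr (.inl 2)) / 2 + imXdW x u) * (v (.inr (.inl 2)) / 2 + imXdW x v))) := by
  have h1 : ∑ a, herm (cX u a) (cX v a) = symX u v := by
    refine Finset.sum_congr rfl fun a _ => ?_
    simp [herm_eq, cX]
    ring
  have h2 : ∑ a, herm (cW u a) (cW v a) = symW u v := by
    refine Finset.sum_congr rfl fun a _ => ?_
    simp [herm_eq, cW]
    ring
  have h3 : herm (cW0 u) (cW0 v) = symW0 u v := by
    simp [herm_eq, cW0, symW0]
    ring
  rw [fiberMetric, h1, h2, h3, herm_eq, herm_eq, formXdX_re, formXdX_re, formXdX_im, formXdX_im,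
    formPhi_eq, formPhi_eq, formW_re, formW_re, formW_im, formW_im]
  ring

/-! ### The two-jet of the metric at the origin -/

/-- The first-order part of `formPhi` at the origin, as a function of the base point `x`. -/
noncomputable def skewPhi (c : ℝ) (x u : Coord n → ℝ) : ℝ := skewW x u + 2 * c * skewX x u

/-- The first differential of the metric at the origin in the direction `x`, where `β` and `γ`
stand for the coefficients `coeffPhi` and `coeffW`. -/
noncomputable def metricD (c β γ : ℝ) (x u v : Coord n → ℝ) : ℝ :=
  β * (cPhi u * skewPhi c x v + cPhi v * skewPhi c x u)
    + γ * (u (.inr (.inl 1)) / 2 * reXdW x v + v (.inr (.inl 1)) / 2 * reXdW x u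
        + u (.inr (.inl 2)) / 2 * imXdW x v + v (.inr (.inl 2)) / 2 * imXdW x u)

/-- The second differential of the metric at the origin in the directions `x` and `y`, where
`α`, `β` and `γ` stand for the coefficients `coeffX`, `coeffPhi` and `coeffW`. -/
noncomputable def metricH (c α β γ : ℝ) (x y u v : Coord n → ℝ) : ℝ :=
  α * (2 * symX x y * symX u v + (symX x u * symX y v + symX y u * symX x v)
      + (skewX x u * skewX y v + skewX y u * skewX x v))
    + β * (skewPhi c x u * skewPhi c y v + skewPhi c y u * skewPhi c x v)
    + γ * (2 * symX x y * symW0 u v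
      + (reXdW x u * reXdW y v + reXdW y u * reXdW x v)
      + (imXdW x u * imXdW y v + imXdW y u * imXdW x v))

/-- The coefficient of the complex hyperbolic metric in `fiberMetric`. -/
noncomputable def coeffX (c ρ : ℝ) : ℝ := (ρ + c) / ρ

/-- The coefficient of the square of `formPhi` in `fiberMetric`. -/
noncomputable def coeffPhi (c ρ : ℝ) : ℝ := 1 / (4 * ρ ^ 2) * ((ρ + c) / (ρ + 2 * c))

/-- The coefficient of the squared norm of `formW` in `fiberMetric`, at the origin. -/
noncomputable def coeffW (c ρ : ℝ) : ℝ := 4 * (ρ + c) / ρ ^ 2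

theorem symX_comm (x y : Coord n → ℝ) : symX x y = symX y x :=
  Finset.sum_congr rfl fun a _ => by ring

theorem hasJet2_apply (i : Coord n) :
    HasJet2 (fun x : Coord n → ℝ => x i) 0 0 (fun v => v i) (fun _ _ => 0) :=
  HasJet2.of_linear _ (fun _ _ => rfl) (fun _ _ => rfl)

theorem hasJet2_gap_inv :
    HasJet2 (fun x : Coord n → ℝ => (gap x)⁻¹) 0 1 (fun _ => 0)
      (fun v w => 2 * symX v w) := by
  have h1 : HasJet2 (fun x : Coord n → ℝ => symX x x) 0 0 (fun _ => 0)
      (fun v w => 2 * symX v w) := by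
    have h := HasJet2.sum Finset.univ fun a : Fin (n - 1) =>
      (((hasJet2_apply (.inl (.inl a))).mul (hasJet2_apply (.inl (.inl a)))).add
        ((hasJet2_apply (.inl (.inr a))).mul (hasJet2_apply (.inl (.inr a))))).const_mul (1 / 4)
    have e : (fun x : Coord n → ℝ => symX x x) = fun x => ∑ a : Fin (n - 1), (1 / 4) *
        (x (.inl (.inl a)) * x (.inl (.inl a)) + x (.inl (.inr a)) * x (.inl (.inr a))) := by
      ext x
      exact Finset.sum_congr rfl fun a _ => by ring
    rw [e]
    refine h.congr_jet (by simp) (by simp) fun v w => ?_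
    rw [symX, Finset.mul_sum]
    exact Finset.sum_congr rfl fun a _ => by ring
  have h2 := ((HasJet2.const 1 (0 : Coord n → ℝ)).add (h1.const_mul (-1))).inv (by norm_num)
  have e : (fun x : Coord n → ℝ => (gap x)⁻¹) = fun x => (1 + -1 * symX x x)⁻¹ := by
    ext x
    rw [gap_eq]
    ring
  rw [e]
  exact h2.congr_jet (by norm_num) (by simp) (by simp)

theorem hasJet2_symX (u : Coord n → ℝ) :
    HasJet2 (fun x => symX x u) 0 0 (fun x => symX x u) (fun _ _ => 0) := by
  refine HasJet2.of_linear _ (fun x y => ?_) (fun k x => ?_)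
  · rw [symX, symX, symX, ← Finset.sum_add_distrib]
    exact Finset.sum_congr rfl fun a _ => by simp; ring
  · rw [symX, symX, Finset.mul_sum]
    exact Finset.sum_congr rfl fun a _ => by simp; ring

theorem hasJet2_skewX (u : Coord n → ℝ) :
    HasJet2 (fun x => skewX x u) 0 0 (fun x => skewX x u) (fun _ _ => 0) := by
  refine HasJet2.of_linear _ (fun x y => ?_) (fun k x => ?_)
  · rw [skewX, skewX, skewX, ← Finset.sum_add_distrib]
    exact Finset.sum_congr rfl fun a _ => by simp; ring
  · rw [skewX, skewX, Finset.mul_sum]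
    exact Finset.sum_congr rfl fun a _ => by simp; ring

theorem hasJet2_reXdW (u : Coord n → ℝ) :
    HasJet2 (fun x => reXdW x u) 0 0 (fun x => reXdW x u) (fun _ _ => 0) := by
  refine HasJet2.of_linear _ (fun x y => ?_) (fun k x => ?_)
  · rw [reXdW, reXdW, reXdW, ← Finset.sum_add_distrib]
    exact Finset.sum_congr rfl fun a _ => by simp; ring
  · rw [reXdW, reXdW, Finset.mul_sum]
    exact Finset.sum_congr rfl fun a _ => by simp; ring

theorem hasJet2_imXdW (u : Coord n → ℝ) :
    HasJet2 (fun x => imXdW x u) 0 0 (fun x => imXdW x u) (fun _ _ => 0) := by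
  refine HasJet2.of_linear _ (fun x y => ?_) (fun k x => ?_)
  · rw [imXdW, imXdW, imXdW, ← Finset.sum_add_distrib]
    exact Finset.sum_congr rfl fun a _ => by simp; ring
  · rw [imXdW, imXdW, Finset.mul_sum]
    exact Finset.sum_congr rfl fun a _ => by simp; ring

theorem hasJet2_skewW (u : Coord n → ℝ) :
    HasJet2 (fun x => skewW x u) 0 0 (fun x => skewW x u) (fun _ _ => 0) := by
  refine HasJet2.of_linear _ (fun x y => ?_) (fun k x => ?_)
  · simp only [skewW, Pi.add_apply, add_mul, Finset.sum_sub_distrib, Finset.sum_add_distrib]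
    ring
  · simp only [skewW, Pi.smul_apply, smul_eq_mul, mul_sub, Finset.mul_sum]
    congr 1
    · ring
    · exact Finset.sum_congr rfl fun a _ => by ring

theorem hasJet2_fiberMetric (c ρ : ℝ) (u v : Coord n → ℝ) :
    HasJet2 (fun x => fiberMetric c ρ x u v) 0 (fiberMetric c ρ 0 u v)
      (fun x => metricD c (coeffPhi c ρ) (coeffW c ρ) x u v)
      (fun x y => metricH c (coeffX c ρ) (coeffPhi c ρ) (coeffW c ρ) x y u v) := by
  have hg := hasJet2_gap_inv (n := n)
  have k := fun r : ℝ => HasJet2.const r (0 : Coord n → ℝ)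
  have hφ := fun u : Coord n → ℝ => ((k (cPhi u)).add (hasJet2_skewW u)).add
    ((hg.mul (hasJet2_skewX u)).const_mul (2 * c))
  have h := (((((hg.mul ((k (symX u v)).add (hg.mul
      (((hasJet2_symX u).mul (hasJet2_symX v)).add
        ((hasJet2_skewX u).mul (hasJet2_skewX v)))))).const_mul ((ρ + c) / ρ)).add
    (((hφ u).mul (hφ v)).const_mul (1 / (4 * ρ ^ 2) * ((ρ + c) / (ρ + 2 * c))))).add
    (k (-2 / ρ * (symW0 u v - symW u v)))).add
    ((hg.mul
      ((((k (u (.inr (.inl 1)) / 2)).add (hasJet2_reXdW u)).mul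
        ((k (v (.inr (.inl 1)) / 2)).add (hasJet2_reXdW v))).add
      (((k (u (.inr (.inl 2)) / 2)).add (hasJet2_imXdW u)).mul
        ((k (v (.inr (.inl 2)) / 2)).add (hasJet2_imXdW v))))).const_mul
      (4 * (ρ + c) / ρ ^ 2)))
  have h' := h.congr_fun fun x => fiberMetric_eq c ρ x u v
  refine h'.congr_jet h'.value.symm (fun x => ?_) (fun x y => ?_)
  · simp only [metricD, skewPhi, coeffPhi, coeffW]
    ring
  · simp only [metricH, skewPhi, symW0, coeffX, coeffPhi, coeffW]
    ring

/-! ### Values on coordinate vectors -/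

@[simp] theorem symX_single_b (a : Fin (n - 1)) (u : Coord n → ℝ) :
    symX (Pi.single (.inl (.inl a)) 1) u = u (.inl (.inl a)) / 4 := by
  simp [symX, Pi.single_apply, ite_div]

@[simp] theorem symX_single_t (a : Fin (n - 1)) (u : Coord n → ℝ) :
    symX (Pi.single (.inl (.inr a)) 1) u = u (.inl (.inr a)) / 4 := by
  simp [symX, Pi.single_apply, ite_div]

@[simp] theorem symX_single_inr (i) (u : Coord n → ℝ) :
    symX (Pi.single (.inr i) 1) u = 0 := by
  simp [symX]

@[simp] theorem skewX_single_b (a : Fin (n - 1)) (u : Coord n → ℝ) :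
    skewX (Pi.single (.inl (.inl a)) 1) u = u (.inl (.inr a)) / 4 := by
  simp [skewX, Pi.single_apply, ite_div]

@[simp] theorem skewX_single_t (a : Fin (n - 1)) (u : Coord n → ℝ) :
    skewX (Pi.single (.inl (.inr a)) 1) u = -u (.inl (.inl a)) / 4 := by
  simp [skewX, Pi.single_apply, neg_div, ite_div]

@[simp] theorem skewX_single_inr (i) (u : Coord n → ℝ) :
    skewX (Pi.single (.inr i) 1) u = 0 := by
  simp [skewX]

@[simp] theorem skewW_single_inl (i) (u : Coord n → ℝ) :
    skewW (Pi.single (.inl i) 1) u = 0 := by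
  simp [skewW]

@[simp] theorem skewW_single_phi (u : Coord n → ℝ) :
    skewW (Pi.single (.inr (.inl 0)) 1) u = 0 := by
  simp [skewW]

@[simp] theorem skewW_single_one (u : Coord n → ℝ) :
    skewW (Pi.single (.inr (.inl 1)) 1) u = -u (.inr (.inl 2)) := by
  simp [skewW]

@[simp] theorem skewW_single_two (u : Coord n → ℝ) :
    skewW (Pi.single (.inr (.inl 2)) 1) u = u (.inr (.inl 1)) := by
  simp [skewW]

@[simp] theorem skewW_single_r (a : Fin (n - 1)) (u : Coord n → ℝ) :
    skewW (Pi.single (.inr (.inr (.inl a))) 1) u = -u (.inr (.inr (.inr a))) := by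
  simp [skewW, Pi.single_apply]

@[simp] theorem skewW_single_s (a : Fin (n - 1)) (u : Coord n → ℝ) :
    skewW (Pi.single (.inr (.inr (.inr a))) 1) u = u (.inr (.inr (.inl a))) := by
  simp [skewW, Pi.single_apply]

@[simp] theorem reXdW_single_b (a : Fin (n - 1)) (u : Coord n → ℝ) :
    reXdW (Pi.single (.inl (.inl a)) 1) u = u (.inr (.inr (.inl a))) / 4 := by
  simp [reXdW, Pi.single_apply, ite_div]

@[simp] theorem reXdW_single_t (a : Fin (n - 1)) (u : Coord n → ℝ) :
    reXdW (Pi.single (.inl (.inr a)) 1) u = u (.inr (.inr (.inr a))) / 4 := by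
  simp [reXdW, Pi.single_apply, ite_div]

@[simp] theorem reXdW_single_inr (i) (u : Coord n → ℝ) :
    reXdW (Pi.single (.inr i) 1) u = 0 := by
  simp [reXdW]

@[simp] theorem imXdW_single_b (a : Fin (n - 1)) (u : Coord n → ℝ) :
    imXdW (Pi.single (.inl (.inl a)) 1) u = -u (.inr (.inr (.inr a))) / 4 := by
  simp [imXdW, Pi.single_apply, neg_div, ite_div]

@[simp] theorem imXdW_single_t (a : Fin (n - 1)) (u : Coord n → ℝ) :
    imXdW (Pi.single (.inl (.inr a)) 1) u = u (.inr (.inr (.inl a))) / 4 := by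
  simp [imXdW, Pi.single_apply, ite_div]

@[simp] theorem imXdW_single_inr (i) (u : Coord n → ℝ) :
    imXdW (Pi.single (.inr i) 1) u = 0 := by
  simp [imXdW]

/-! ### The Gram matrix at the origin -/

variable (n) in
/-- The diagonal entries of the metric at the origin. -/
noncomputable def gramDiag (c ρ : ℝ) : Coord n → ℝ :=
  blockVec n ((ρ + c) / (4 * ρ)) (1 / (4 * ρ ^ 2) * ((ρ + c) / (ρ + 2 * c)))
    ((ρ + 2 * c) / (2 * ρ ^ 2)) (1 / (2 * ρ))

theorem fiberMetric_zero {c ρ : ℝ} (hc : 0 ≤ c) (hρ : 0 < ρ) (u v : Coord n → ℝ) :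
    fiberMetric c ρ 0 u v = ∑ i, gramDiag n c ρ i * (u i * v i) := by
  have h0 : gap (0 : Coord n → ℝ) = 1 := by simp [gap_eq, symX]
  rw [fiberMetric_eq, h0]
  simp only [symX, skewX, skewW, reXdW, imXdW, symW, symW0, cPhi, gramDiag, blockVec,
    Fintype.sum_sum_type, Fin.sum_univ_three, Pi.zero_apply, zero_mul, add_zero, zero_div,
    Finset.sum_const_zero, sub_zero, neg_zero, Sum.elim_inl, Sum.elim_inr, ← Finset.mul_sum,
    ← Finset.sum_div, Finset.sum_add_distrib]
  simp
  have : ρ + 2 * c ≠ 0 := by positivity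
  field_simp
  ring

theorem fiberGram_zero {c ρ : ℝ} (hc : 0 ≤ c) (hρ : 0 < ρ) :
    fiberGram n c ρ 0 = Matrix.diagonal (gramDiag n c ρ) := by
  ext i j
  rw [fiberGram, Matrix.of_apply, fiberMetric_zero hc hρ, Matrix.diagonal_apply]
  rcases eq_or_ne i j with rfl | hij
  · simp [Pi.single_apply]
  · simp [Pi.single_apply, hij, hij.symm]

theorem gramDiag_ne_zero {c ρ : ℝ} (hc : 0 ≤ c) (hρ : 0 < ρ) (i : Coord n) :
    gramDiag n c ρ i ≠ 0 := by
  have : 0 < ρ + c := by positivity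
  have : 0 < ρ + 2 * c := by positivity
  have : 0 < gramDiag n c ρ i := by
    rcases i with i | i | i
    · simp [gramDiag, blockVec]; positivity
    · fin_cases i <;> simp [gramDiag, blockVec] <;> positivity
    · simp [gramDiag, blockVec]; positivity
  exact this.ne'

/-! ### The Ricci tensor at the origin -/

/-- The first derivatives `∂_k g_{ij}` of the metric at the origin. -/
noncomputable def gramD (c β γ : ℝ) (k i j : Coord n) : ℝ :=
  metricD c β γ (Pi.single k 1) (Pi.single i 1) (Pi.single j 1)

/-- The second derivatives `∂_k ∂_l g_{ij}` of the metric at the origin. -/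
noncomputable def gramH (c α β γ : ℝ) (k l i j : Coord n) : ℝ :=
  metricH c α β γ (Pi.single k 1) (Pi.single l 1) (Pi.single i 1) (Pi.single j 1)

/-- Each coordinate line through the origin has zero acceleration there, so that the first of
the two products of Christoffel symbols drops out of the Ricci tensor. -/
theorem lowerChristoffel_trace (c β γ : ℝ) (p i : Coord n) :
    lowerChristoffel (gramD c β γ) p i i = 0 := by
  rcases i with (i | i) | i | i | i
  case inr.inl =>
    fin_cases i <;> rcases p with (p | p) | p | p | p <;> (try fin_cases p) <;>
      simp [lowerChristoffel, gramD, metricD, skewPhi, cPhi]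
  all_goals
    rcases p with (p | p) | p | p | p <;> (try fin_cases p) <;>
      simp [lowerChristoffel, gramD, metricD, skewPhi, cPhi, Pi.single_apply]

/-- The Ricci tensor at the origin in terms of the two-jet of the metric, where `h` is the
diagonal of the inverse Gram matrix; the symbols `Γ_{p,ii}` are zero and do not occur. The
coefficients are arbitrary parameters here, so that every entry is a polynomial in them. -/
noncomputable def ricciSum (c α β γ : ℝ) (h : Coord n → ℝ) (j k : Coord n) : ℝ :=
  (∑ i, h i / 2 * (gramH c α β γ i k i j + gramH c α β γ i j i k
      - gramH c α β γ i i j k - gramH c α β γ j k i i))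
    + ∑ i, ∑ p, h i * h p *
      (lowerChristoffel (gramD c β γ) p i j * lowerChristoffel (gramD c β γ) p i k)

theorem ricciMatrix_fiberGram {c ρ : ℝ} (hc : 0 ≤ c) (hρ : 0 < ρ) (j k : Coord n) :
    ricciMatrix (fiberGram n c ρ) 0 j k =
      ricciSum c (coeffX c ρ) (coeffPhi c ρ) (coeffW c ρ) (fun i => (gramDiag n c ρ i)⁻¹) j k := by
  have hJ := fun i j : Coord n =>
    hasJet2_fiberMetric c ρ (Pi.single i (1 : ℝ)) (Pi.single j (1 : ℝ))
  rw [ricciMatrix_eq_of_jet (G := fiberGram n c ρ) (D := gramD c (coeffPhi c ρ) (coeffW c ρ))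
    (H := gramH c (coeffX c ρ) (coeffPhi c ρ) (coeffW c ρ))
    (fun i j => (hJ i j).contDiffAt) (fiberGram_zero hc hρ)
    (gramDiag_ne_zero hc hρ) (fun k i j => (hJ i j).first _) (fun k l i j => (hJ i j).second _ _)
    (fun k i j => ?_) (fun k l i j => ?_) (fun k l i j => ?_) j k]
  · simp only [lowerChristoffel_trace, zero_mul, zero_sub, mul_neg, Finset.sum_neg_distrib,
      sub_neg_eq_add, ricciSum]
  · simp only [gramD, metricD]
    ring
  · simp only [gramH, metricH]
    rw [symX_comm (Pi.single k 1) (Pi.single l 1)]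
    ring
  · simp only [gramH, metricH, symW0]
    rw [symX_comm (Pi.single i 1) (Pi.single j 1)]
    ring

/-! ### Off-diagonal entries of the Ricci tensor -/

/-- The factors by which the coordinates are multiplied under the map `X^a ↦ x_a X^a`,
`w^0 ↦ y w^0`, `w^a ↦ y x_a w^a` with signs `x_a`, `y`, followed by complex conjugation of the
coordinates `X^a`, `w^0`, `w^a` and `φ ↦ -φ` if `κ = -1`. -/
def signs (x : Fin (n - 1) → ℝ) (y κ : ℝ) : Coord n → ℝ :=
  Sum.elim (Sum.elim x fun a => κ * x a)
    (Sum.elim ![κ, y, κ * y] (Sum.elim (fun a => y * x a) fun a => κ * (y * x a)))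

theorem signs_mul_self {x : Fin (n - 1) → ℝ} {y κ : ℝ} (hx : ∀ a, x a * x a = 1) (hy : y * y = 1)
    (hκ : κ * κ = 1) (i : Coord n) : signs x y κ i * signs x y κ i = 1 := by
  rcases i with (a | a) | a | a | a
  · simp [signs, hx]
  · simp [signs, mul_mul_mul_comm, hx, hκ]
  · fin_cases a <;> simp [signs] <;> grind
  · simp [signs, mul_mul_mul_comm, hx, hy]
  · simp [signs, mul_mul_mul_comm, hx, hy, hκ]

theorem symX_signs {x : Fin (n - 1) → ℝ} {y κ : ℝ} (hx : ∀ a, x a * x a = 1) (hκ : κ * κ = 1)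
    (u v : Coord n → ℝ) : symX (signs x y κ * u) (signs x y κ * v) = symX u v := by
  refine Finset.sum_congr rfl fun a _ => ?_
  have := hx a
  simp only [signs, Pi.mul_apply, Sum.elim_inl, Sum.elim_inr]
  grind

theorem skewX_signs {x : Fin (n - 1) → ℝ} {y κ : ℝ} (hx : ∀ a, x a * x a = 1)
    (u v : Coord n → ℝ) : skewX (signs x y κ * u) (signs x y κ * v) = κ * skewX u v := by
  rw [skewX, skewX, Finset.mul_sum]
  refine Finset.sum_congr rfl fun a _ => ?_
  have := hx a
  simp only [signs, Pi.mul_apply, Sum.elim_inl, Sum.elim_inr]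
  grind

theorem skewW_signs {x : Fin (n - 1) → ℝ} {y κ : ℝ} (hx : ∀ a, x a * x a = 1) (hy : y * y = 1)
    (u v : Coord n → ℝ) : skewW (signs x y κ * u) (signs x y κ * v) = κ * skewW u v := by
  rw [skewW, skewW, mul_sub, Finset.mul_sum]
  congr 1
  · simp only [signs, Pi.mul_apply, Sum.elim_inl, Sum.elim_inr, Matrix.cons_val]
    grind
  · refine Finset.sum_congr rfl fun a _ => ?_
    have := hx a
    simp only [signs, Pi.mul_apply, Sum.elim_inl, Sum.elim_inr]
    grind

theorem reXdW_signs {x : Fin (n - 1) → ℝ} {y κ : ℝ} (hx : ∀ a, x a * x a = 1) (hκ : κ * κ = 1)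
    (u v : Coord n → ℝ) : reXdW (signs x y κ * u) (signs x y κ * v) = y * reXdW u v := by
  rw [reXdW, reXdW, Finset.mul_sum]
  refine Finset.sum_congr rfl fun a _ => ?_
  have := hx a
  simp only [signs, Pi.mul_apply, Sum.elim_inl, Sum.elim_inr]
  grind

theorem imXdW_signs {x : Fin (n - 1) → ℝ} {y κ : ℝ} (hx : ∀ a, x a * x a = 1)
    (u v : Coord n → ℝ) : imXdW (signs x y κ * u) (signs x y κ * v) = κ * y * imXdW u v := by
  rw [imXdW, imXdW, Finset.mul_sum]
  refine Finset.sum_congr rfl fun a _ => ?_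
  have := hx a
  simp only [signs, Pi.mul_apply, Sum.elim_inl, Sum.elim_inr]
  grind

theorem symX_smul_smul (r t : ℝ) (u v : Coord n → ℝ) :
    symX (r • u) (t • v) = r * t * symX u v := by
  simp only [symX, Pi.smul_apply, smul_eq_mul, Finset.mul_sum]
  exact Finset.sum_congr rfl fun a _ => by ring

theorem skewX_smul_smul (r t : ℝ) (u v : Coord n → ℝ) :
    skewX (r • u) (t • v) = r * t * skewX u v := by
  simp only [skewX, Pi.smul_apply, smul_eq_mul, Finset.mul_sum]
  exact Finset.sum_congr rfl fun a _ => by ring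

theorem skewW_smul_smul (r t : ℝ) (u v : Coord n → ℝ) :
    skewW (r • u) (t • v) = r * t * skewW u v := by
  simp only [skewW, Pi.smul_apply, smul_eq_mul, mul_sub, Finset.mul_sum]
  congr 1
  · ring
  · exact Finset.sum_congr rfl fun a _ => by ring

theorem reXdW_smul_smul (r t : ℝ) (u v : Coord n → ℝ) :
    reXdW (r • u) (t • v) = r * t * reXdW u v := by
  simp only [reXdW, Pi.smul_apply, smul_eq_mul, Finset.mul_sum]
  exact Finset.sum_congr rfl fun a _ => by ring

theorem imXdW_smul_smul (r t : ℝ) (u v : Coord n → ℝ) :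
    imXdW (r • u) (t • v) = r * t * imXdW u v := by
  simp only [imXdW, Pi.smul_apply, smul_eq_mul, Finset.mul_sum]
  exact Finset.sum_congr rfl fun a _ => by ring

theorem signs_mul_single (x : Fin (n - 1) → ℝ) (y κ : ℝ) (i : Coord n) :
    signs x y κ * Pi.single i (1 : ℝ) = signs x y κ i • Pi.single i 1 := by
  ext j
  rcases eq_or_ne j i with rfl | h
  · simp
  · simp [h]

theorem gramD_signs {x : Fin (n - 1) → ℝ} {y κ : ℝ} (hx : ∀ a, x a * x a = 1) (hy : y * y = 1)
    (hκ : κ * κ = 1) (c β γ : ℝ) (k i j : Coord n) :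
    signs x y κ k * signs x y κ i * signs x y κ j * gramD c β γ k i j = gramD c β γ k i j := by
  have h1 : ∀ r s t : ℝ, ∀ u v w : Coord n → ℝ, metricD c β γ (r • u) (s • v) (t • w) =
      r * s * t * metricD c β γ u v w := by
    intro r s t u v w
    simp only [metricD, skewPhi, cPhi, skewX_smul_smul, skewW_smul_smul, reXdW_smul_smul,
      imXdW_smul_smul, Pi.smul_apply, smul_eq_mul]
    ring
  have h2 : ∀ u v w : Coord n → ℝ, metricD c β γ (signs x y κ * u) (signs x y κ * v)
      (signs x y κ * w) = metricD c β γ u v w := by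
    intro u v w
    have e : ∀ u : Coord n → ℝ, cPhi (signs x y κ * u) = κ * cPhi u := fun u => rfl
    have e1 : ∀ u : Coord n → ℝ, (signs x y κ * u) (.inr (.inl 1)) = y * u (.inr (.inl 1)) :=
      fun u => rfl
    have e2 : ∀ u : Coord n → ℝ, (signs x y κ * u) (.inr (.inl 2)) = κ * y * u (.inr (.inl 2)) :=
      fun u => rfl
    simp only [metricD, skewPhi, skewX_signs hx, skewW_signs hx hy, reXdW_signs hx hκ,
      imXdW_signs hx, e, e1, e2]
    grind
  rw [gramD, ← h1, ← signs_mul_single, ← signs_mul_single, ← signs_mul_single, h2]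

theorem gramH_signs {x : Fin (n - 1) → ℝ} {y κ : ℝ} (hx : ∀ a, x a * x a = 1) (hy : y * y = 1)
    (hκ : κ * κ = 1) (c α β γ : ℝ) (k l i j : Coord n) :
    signs x y κ k * signs x y κ l * signs x y κ i * signs x y κ j * gramH c α β γ k l i j =
      gramH c α β γ k l i j := by
  have h1 : ∀ q r s t : ℝ, ∀ z u v w : Coord n → ℝ,
      metricH c α β γ (q • z) (r • u) (s • v) (t • w) =
        q * r * s * t * metricH c α β γ z u v w := by
    intro q r s t z u v w
    simp only [metricH, skewPhi, symW0, symX_smul_smul, skewX_smul_smul, skewW_smul_smul,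
      reXdW_smul_smul, imXdW_smul_smul, Pi.smul_apply, smul_eq_mul]
    ring
  have h2 : ∀ z u v w : Coord n → ℝ, metricH c α β γ (signs x y κ * z) (signs x y κ * u)
      (signs x y κ * v) (signs x y κ * w) = metricH c α β γ z u v w := by
    intro z u v w
    have e1 : ∀ u : Coord n → ℝ, (signs x y κ * u) (.inr (.inl 1)) = y * u (.inr (.inl 1)) :=
      fun u => rfl
    have e2 : ∀ u : Coord n → ℝ, (signs x y κ * u) (.inr (.inl 2)) = κ * y * u (.inr (.inl 2)) :=
      fun u => rfl
    have e3 : symW0 (signs x y κ * v) (signs x y κ * w) = symW0 v w := by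
      simp only [symW0, e1, e2]
      grind
    simp only [metricH, skewPhi, symX_signs hx hκ, skewX_signs hx, skewW_signs hx hy,
      reXdW_signs hx hκ, imXdW_signs hx, e3]
    linear_combination
      (α * (skewX z v * skewX u w + skewX u v * skewX z w)
        + β * ((skewW z v + 2 * c * skewX z v) * (skewW u w + 2 * c * skewX u w)
          + (skewW u v + 2 * c * skewX u v) * (skewW z w + 2 * c * skewX z w))
        + y * y * γ * (imXdW z v * imXdW u w + imXdW u v * imXdW z w)) * hκ
      + γ * (reXdW z v * reXdW u w + reXdW u v * reXdW z w
        + imXdW z v * imXdW u w + imXdW u v * imXdW z w) * hy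
  rw [gramH, ← h1, ← signs_mul_single, ← signs_mul_single, ← signs_mul_single, ← signs_mul_single,
    h2]

/-- Invariance of the Ricci tensor at the origin under the sign changes of the coordinates,
which are isometries. -/
theorem ricciSum_signs {x : Fin (n - 1) → ℝ} {y κ : ℝ} (hx : ∀ a, x a * x a = 1) (hy : y * y = 1)
    (hκ : κ * κ = 1) (c α β γ : ℝ) (h : Coord n → ℝ) (j k : Coord n) :
    signs x y κ j * signs x y κ k * ricciSum c α β γ h j k = ricciSum c α β γ h j k := by
  have hs := signs_mul_self hx hy hκ
  have hH := gramH_signs hx hy hκ c α β γ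
  have hL : ∀ p i j, signs x y κ p * signs x y κ i * signs x y κ j *
      lowerChristoffel (gramD c β γ) p i j = lowerChristoffel (gramD c β γ) p i j := by
    intro p i j
    have hD := gramD_signs hx hy hκ c β γ
    simp only [lowerChristoffel]
    linear_combination (1 / 2) * (hD i j p + hD j i p - hD p i j)
  rw [ricciSum, mul_add, Finset.mul_sum, Finset.mul_sum]
  congr 1
  · refine Finset.sum_congr rfl fun i _ => ?_
    linear_combination (h i / 2) * (hH i k i j + hH i j i k - hH i i j k - hH j k i i)
      - (h i / 2) * (signs x y κ j * signs x y κ k) * (gramH c α β γ i k i j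
        + gramH c α β γ i j i k - gramH c α β γ i i j k - gramH c α β γ j k i i) * hs i
  · refine Finset.sum_congr rfl fun i _ => ?_
    rw [Finset.mul_sum]
    refine Finset.sum_congr rfl fun p _ => ?_
    have hm := congrArg₂ (· * ·) (hL p i j) (hL p i k)
    linear_combination (h i * h p) * hm - (h i * h p) * (signs x y κ j * signs x y κ k)
      * (lowerChristoffel (gramD c β γ) p i j * lowerChristoffel (gramD c β γ) p i k)
      * (signs x y κ i * signs x y κ i * hs p + hs i)

/-- The Ricci tensor is diagonal at the origin, by its invariance under `signs`. -/
theorem ricciSum_of_ne (c α β γ : ℝ) (h : Coord n → ℝ) {j k : Coord n} (hjk : j ≠ k) :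
    ricciSum c α β γ h j k = 0 := by
  -- It is enough to find a sign change under which the two coordinates behave differently.
  suffices hs : ∃ (x : Fin (n - 1) → ℝ) (y κ : ℝ), (∀ a, x a * x a = 1) ∧ y * y = 1 ∧ κ * κ = 1 ∧
      signs x y κ j * signs x y κ k = -1 by
    obtain ⟨x, y, κ, hx, hy, hκ, hs⟩ := hs
    have := ricciSum_signs hx hy hκ c α β γ h j k
    rw [hs] at this
    linarith
  have h1 : ∀ a b : Fin (n - 1),
      (if b = a then (-1 : ℝ) else 1) * (if b = a then -1 else 1) = 1 := by
    intro a b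
    split_ifs <;> norm_num
  -- Complex conjugation is tried first, then the sign of all `w^0`, `w^a`, then that of all `X^a`,
  -- `w^a`, and for two coordinates of the same kind the sign of a single pair `X^a`, `w^a`.
  rcases j with (a | a) | a | a | a <;> (try fin_cases a) <;>
    rcases k with (b | b) | b | b | b <;> (try fin_cases b) <;>
    first
    | exact absurd rfl hjk
    | refine ⟨fun _ => 1, 1, -1, by norm_num, by norm_num, by norm_num, ?_⟩; norm_num [signs]; done
    | refine ⟨fun _ => 1, -1, 1, by norm_num, by norm_num, by norm_num, ?_⟩; norm_num [signs]; done
    | refine ⟨fun _ => -1, 1, 1, by norm_num, by norm_num, by norm_num, ?_⟩; norm_num [signs]; done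
    | have : b ≠ a := fun e => hjk (by rw [e])
      refine ⟨fun i => if i = a then -1 else 1, 1, 1, h1 a, by norm_num, by norm_num, ?_⟩
      simp [signs, this]

/-! ### Diagonal entries of the Ricci tensor -/

set_option maxHeartbeats 2000000 in
/-- The diagonal entries of the Ricci tensor at the origin, as polynomials in the coefficients. -/
theorem ricciSum_self (c α β γ h₁ h₂ h₃ h₄ : ℝ) (i : Coord n) :
    ricciSum c α β γ (blockVec n h₁ h₂ h₃ h₄) i i = blockVec n
      (-(h₁ * α * (((n - 1 : ℕ) : ℝ) + 1)) / 8 - 3 * c ^ 2 * h₁ * β / 4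
        + c ^ 2 * h₁ * h₂ * β ^ 2 / 4 - (h₃ + h₄) * γ / 8 + h₃ * h₄ * γ ^ 2 / 64)
      (β ^ 2 * (2 * h₃ ^ 2 + ((n - 1 : ℕ) : ℝ) * (c ^ 2 * h₁ ^ 2 / 2 + 2 * h₄ ^ 2)))
      (((n - 1 : ℕ) : ℝ) * (h₁ * h₄ * γ ^ 2 / 64 - h₁ * γ / 8) - 3 * h₃ * β + h₂ * h₃ * β ^ 2)
      (h₁ * h₃ * γ ^ 2 / 64 - h₁ * γ / 8 - 3 * h₄ * β + h₂ * h₄ * β ^ 2) i := by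
  rcases i with (a | a) | a | a | a <;> (try fin_cases a) <;>
  · simp [ricciSum, Fintype.sum_sum_type, Fin.sum_univ_three, lowerChristoffel, gramD, gramH,
      metricD, metricH, skewPhi, symW0, cPhi, Pi.single_apply, blockVec]
    -- The Kronecker deltas are expanded so that every sum contains a single product of them.
    simp only [Finset.sum_add_distrib, mul_add, add_mul, mul_sub, sub_mul, mul_ite, ite_mul,
      ite_div, mul_neg, neg_mul, neg_neg, Finset.sum_ite_eq, Finset.sum_ite_eq',
      Finset.sum_sub_distrib, Finset.sum_neg_distrib, mul_zero, zero_mul, zero_div, mul_one,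
      Finset.mem_univ, if_true]
    ring_nf <;> simp [ite_pow] <;> ring

theorem blockVec_inv (a₁ a₂ a₃ a₄ : ℝ) :
    (fun i => (blockVec n a₁ a₂ a₃ a₄ i)⁻¹) = blockVec n a₁⁻¹ a₂⁻¹ a₃⁻¹ a₄⁻¹ := by
  ext i
  rcases i with i | i | i
  · rfl
  · fin_cases i <;> rfl
  · rfl

/-! ### The dependence on `ρ` -/

variable (n) in
/-- The diagonal entries of the endomorphism `A_ρ`. -/
noncomputable def shapeDiag (c ρ : ℝ) (i : Coord n) : ℝ :=
  -(1 / (2 * ρ)) * blockVec n (c / (ρ + c))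
    ((2 * ρ ^ 2 + 5 * c * ρ + 4 * c ^ 2) / ((ρ + c) * (ρ + 2 * c)))
    ((ρ + 4 * c) / (ρ + 2 * c)) 1 i

/-- `A_ρ` is half the logarithmic derivative of the metric at the origin. -/
theorem hasDerivAt_gramDiag {c ρ : ℝ} (hc : 0 ≤ c) (hρ : 0 < ρ) (i : Coord n) :
    HasDerivAt (fun r => gramDiag n c r i) (2 * shapeDiag n c ρ i * gramDiag n c ρ i) ρ := by
  have h0 : ρ ≠ 0 := hρ.ne'
  have h1 : ρ + c ≠ 0 := by positivity
  have h2 : ρ + 2 * c ≠ 0 := by positivity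
  have hid := hasDerivAt_id' ρ
  have d1 := hid.add_const c
  have d2 := hid.add_const (2 * c)
  have e1 : HasDerivAt (fun r => (r + c) / (4 * r)) _ ρ :=
    d1.fun_div (hid.const_mul 4) (by positivity)
  have e2 : HasDerivAt (fun r => 1 / (4 * r ^ 2) * ((r + c) / (r + 2 * c))) _ ρ :=
    (((hasDerivAt_const ρ (1 : ℝ)).fun_div ((hid.fun_pow 2).const_mul 4) (by positivity))).fun_mul
      (d1.fun_div d2 h2)
  have e3 : HasDerivAt (fun r => (r + 2 * c) / (2 * r ^ 2)) _ ρ :=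
    d2.fun_div ((hid.fun_pow 2).const_mul 2) (by positivity)
  have e4 : HasDerivAt (fun r : ℝ => 1 / (2 * r)) _ ρ :=
    (hasDerivAt_const ρ (1 : ℝ)).fun_div (hid.const_mul 2) (by positivity)
  rcases i with i | i | i
  · refine e1.congr_deriv ?_
    simp [shapeDiag, gramDiag, blockVec]
    field_simp
    ring
  · fin_cases i
    · refine e2.congr_deriv ?_
      simp [shapeDiag, gramDiag, blockVec]
      field_simp
      ring
    all_goals
      refine e3.congr_deriv ?_
      simp [shapeDiag, gramDiag, blockVec]
      field_simp
      ring
  · refine e4.congr_deriv ?_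
    simp [shapeDiag, gramDiag, blockVec]
    field_simp

/-- The derivative of `A_ρ` is written so that it exhibits the formula for the Ricci tensor: its
expression in terms of the principal Ricci curvatures is free of `n`, although each term depends
on it. -/
theorem hasDerivAt_shapeDiag {c ρ : ℝ} (hc : 0 ≤ c) (hρ : 0 < ρ) (i : Coord n) :
    HasDerivAt (fun r => shapeDiag n c r i) (lapse c ρ * (blockVec n (r₁ n c ρ) (r₂ n c ρ)
      (r₃ n c ρ) (r₄ c ρ) i + 2 * (n + 2) + 4 * n * ρ * shapeDiag n c ρ i)) ρ := by
  have h0 : ρ ≠ 0 := hρ.ne'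
  have h1 : ρ + c ≠ 0 := by positivity
  have h2 : ρ + 2 * c ≠ 0 := by positivity
  have hid := hasDerivAt_id' ρ
  have d1 := hid.add_const c
  have d2 := hid.add_const (2 * c)
  have d0 : HasDerivAt (fun r : ℝ => -(1 / (2 * r))) _ ρ :=
    ((hasDerivAt_const ρ (1 : ℝ)).fun_div (hid.const_mul 2) (by positivity)).fun_neg
  have e1 : HasDerivAt (fun r => -(1 / (2 * r)) * (c / (r + c))) _ ρ :=
    d0.fun_mul ((hasDerivAt_const ρ c).fun_div d1 h1)
  have e2 : HasDerivAt (fun r => -(1 / (2 * r)) *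
      ((2 * r ^ 2 + 5 * c * r + 4 * c ^ 2) / ((r + c) * (r + 2 * c)))) _ ρ :=
    d0.fun_mul (((((hid.fun_pow 2).const_mul 2).fun_add (hid.const_mul (5 * c))).add_const
      (4 * c ^ 2)).fun_div (d1.fun_mul d2) (mul_ne_zero h1 h2))
  have e3 : HasDerivAt (fun r => -(1 / (2 * r)) * ((r + 4 * c) / (r + 2 * c))) _ ρ :=
    d0.fun_mul ((hid.add_const (4 * c)).fun_div d2 h2)
  have e4 : HasDerivAt (fun r : ℝ => -(1 / (2 * r)) * 1) _ ρ := d0.mul_const 1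
  rcases i with i | i | i
  · refine e1.congr_deriv ?_
    simp [shapeDiag, blockVec, lapse, r₁]
    field_simp
    ring
  · fin_cases i
    · refine e2.congr_deriv ?_
      simp [shapeDiag, blockVec, lapse, r₂]
      field_simp
      ring
    all_goals
      refine e3.congr_deriv ?_
      simp [shapeDiag, blockVec, lapse, r₃]
      field_simp
      ring
  · refine e4.congr_deriv ?_
    simp [shapeDiag, blockVec, lapse, r₄]
    field_simp
    ring

theorem hasDerivAt_fiberMetric_zero {c ρ : ℝ} (hc : 0 ≤ c) (hρ : 0 < ρ) (u v : Coord n → ℝ) :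
    HasDerivAt (fun r => fiberMetric c r 0 u v)
      (∑ i, 2 * shapeDiag n c ρ i * gramDiag n c ρ i * (u i * v i)) ρ := by
  have h : HasDerivAt (fun r => ∑ i, gramDiag n c r i * (u i * v i))
      (∑ i, 2 * shapeDiag n c ρ i * gramDiag n c ρ i * (u i * v i)) ρ :=
    HasDerivAt.fun_sum fun i _ => (hasDerivAt_gramDiag hc hρ i).mul_const _
  refine h.congr_of_eventuallyEq ?_
  filter_upwards [lt_mem_nhds hρ] with r hr
  exact fiberMetric_zero hc hr u v

/-! ### The second fundamental form -/

theorem differentiableAt_fiberMetric {c ρ : ℝ} (hc : 0 ≤ c) (hρ : 0 < ρ) (u v : Coord n → ℝ) :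
    DifferentiableAt ℝ (fun y : Unit ⊕ Coord n → ℝ =>
      fiberMetric c (y (.inl ())) (fun i => y (.inr i)) u v) (Sum.elim (fun _ => ρ) 0) := by
  have h0 : ρ ≠ 0 := hρ.ne'
  have h1 : ρ + 2 * c ≠ 0 := by positivity
  have hg : gap (fun i : Coord n =>
      (Sum.elim (fun _ => ρ) 0 : Unit ⊕ Coord n → ℝ) (.inr i)) ≠ 0 := by
    simp [gap_eq, symX]
  simp only [fiberMetric_eq, gap_eq, div_eq_mul_inv] at hg ⊢
  unfold symX skewX skewW reXdW imXdW at *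
  fun_prop (disch := first | assumption | (simp; done) | (simp; assumption))

/-- Only the derivatives of the Gram matrix with respect to `ρ` contribute to `A_ρ`, because the
ambient metric is block diagonal and the coefficient of `dρ²` depends on `ρ` only. -/
theorem shapeA_eq {c ρ : ℝ} (hc : 0 ≤ c) (hρ : 0 < ρ) :
    shapeA n c ρ = Matrix.diagonal (shapeDiag n c ρ) := by
  have hG : ambientGram n c (Sum.elim (fun _ => ρ) 0) =
      Matrix.diagonal (Sum.elim (fun _ => lapse c ρ) (gramDiag n c ρ)) := by
    have : (Matrix.of fun _ _ => lapse c ρ : Matrix Unit Unit ℝ) =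
        Matrix.diagonal fun _ => lapse c ρ := by
      ext
      simp
    rw [← Matrix.fromBlocks_diagonal, ← fiberGram_zero hc hρ, ← this]
    rfl
  have hf : lapse c ρ ≠ 0 := by
    have : 0 < lapse c ρ := by
      rw [lapse]
      positivity
    exact this.ne'
  have hne : ∀ i, (Sum.elim (fun _ => lapse c ρ) (gramDiag n c ρ) : Unit ⊕ Coord n → ℝ) i ≠ 0 := by
    rintro (i | i)
    · exact hf
    · exact gramDiag_ne_zero hc hρ i
  -- The partial derivative is computed along the line `r ↦ (r, 0)`.
  have hd : ∀ i j : Coord n, pderiv (.inl ()) (fun y => ambientGram n c y (.inr i) (.inr j))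
      (Sum.elim (fun _ => ρ) 0) =
        if i = j then 2 * shapeDiag n c ρ i * gramDiag n c ρ i else 0 := by
    intro i j
    have h := differentiableAt_fiberMetric hc hρ (Pi.single i (1 : ℝ)) (Pi.single j 1)
    have hline : HasDerivAt (fun r : ℝ => (Sum.elim (fun _ => r) 0 : Unit ⊕ Coord n → ℝ))
        (Pi.single (.inl ()) 1) ρ := by
      rw [hasDerivAt_pi]
      rintro (k | k)
      · simpa using hasDerivAt_id' ρ
      · simpa using hasDerivAt_const ρ (0 : ℝ)
    have h1 := h.hasFDerivAt.comp_hasDerivAt ρ hline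
    have h2 := h1.unique (hasDerivAt_fiberMetric_zero hc hρ (Pi.single i 1) (Pi.single j 1))
    refine h2.trans ?_
    rcases eq_or_ne i j with rfl | hij
    · simp [Pi.single_apply]
    · simp [Pi.single_apply, hij, hij.symm]
  ext k i
  have hz : ∀ m (x : Unit ⊕ Coord n → ℝ), pderiv m (fun _ => (0 : ℝ)) x = 0 := by
    intro m x
    simp [pderiv]
  have h01 : ∀ (j : Coord n) (y : Unit ⊕ Coord n → ℝ), ambientGram n c y (.inl ()) (.inr j) = 0 :=
    fun _ _ => rfl
  have h10 : ∀ (j : Coord n) (y : Unit ⊕ Coord n → ℝ), ambientGram n c y (.inr j) (.inl ()) = 0 :=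
    fun _ _ => rfl
  rw [shapeA, Matrix.of_apply, christoffel, hG, inv_diagonal_of_ne_zero hne, Fintype.sum_sum_type]
  simp only [h01, h10, hz, hd, Matrix.diagonal_apply]
  have := gramDiag_ne_zero hc hρ k
  rcases eq_or_ne k i with rfl | hki
  · simp
    field_simp
  · simp [hki]

/-! ### Principal Ricci curvatures -/

theorem ricciMatrix_eq_diagonal (hn : 1 ≤ n) {c ρ : ℝ} (hc : 0 ≤ c) (hρ : 0 < ρ) :
    ricciMatrix (fiberGram n c ρ) 0 = Matrix.diagonal fun i =>
      gramDiag n c ρ i * blockVec n (r₁ n c ρ) (r₂ n c ρ) (r₃ n c ρ) (r₄ c ρ) i := by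
  have h0 : ρ ≠ 0 := hρ.ne'
  have h1 : ρ + c ≠ 0 := by positivity
  have h2 : ρ + 2 * c ≠ 0 := by positivity
  ext j k
  rw [ricciMatrix_fiberGram hc hρ, Matrix.diagonal_apply]
  split_ifs with hjk
  · subst hjk
    unfold gramDiag
    rw [blockVec_inv, ricciSum_self]
    simp only [Nat.cast_sub hn, Nat.cast_one]
    rcases j with j | j | j
    · simp [blockVec, coeffX, coeffPhi, coeffW, r₁]
      field_simp
      ring
    · fin_cases j
      · simp [blockVec, coeffPhi, r₂]
        field_simp
        ring
      all_goals
        simp [blockVec, coeffPhi, coeffW, r₃]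
        field_simp
        ring
    · simp [blockVec, coeffPhi, coeffW, r₄]
      field_simp
      ring
  · exact ricciSum_of_ne _ _ _ _ _ hjk

theorem ricciEndo_eq_diagonal (hn : 1 ≤ n) {c ρ : ℝ} (hc : 0 ≤ c) (hρ : 0 < ρ) :
    ricciEndo (fiberGram n c ρ) 0 =
      Matrix.diagonal (blockVec n (r₁ n c ρ) (r₂ n c ρ) (r₃ n c ρ) (r₄ c ρ)) := by
  rw [ricciEndo, ricciMatrix_eq_diagonal hn hc hρ, fiberGram_zero hc hρ,
    inv_diagonal_of_ne_zero (gramDiag_ne_zero hc hρ), Matrix.diagonal_mul_diagonal]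
  congr 1
  ext i
  exact inv_mul_cancel_left₀ (gramDiag_ne_zero hc hρ i) _

theorem charpoly_diagonal_blockVec (hn : 1 ≤ n) (a₁ a₂ a₃ a₄ : ℝ) :
    (Matrix.diagonal (blockVec n a₁ a₂ a₃ a₄)).charpoly =
      (Polynomial.X - Polynomial.C a₁) ^ (2 * n - 2) * (Polynomial.X - Polynomial.C a₂)
        * (Polynomial.X - Polynomial.C a₃) ^ 2
        * (Polynomial.X - Polynomial.C a₄) ^ (2 * n - 2) := by
  have h : 2 * n - 2 = n - 1 + (n - 1) := by omega
  rw [Matrix.charpoly_diagonal, h, pow_add, pow_add]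
  simp [Fintype.prod_sum_type, Fin.prod_univ_three, blockVec]
  ring

theorem shapeADeriv_eq {c ρ : ℝ} (hc : 0 ≤ c) (hρ : 0 < ρ) :
    shapeADeriv n c ρ = Matrix.diagonal fun i => lapse c ρ * (blockVec n (r₁ n c ρ) (r₂ n c ρ)
      (r₃ n c ρ) (r₄ c ρ) i + 2 * (n + 2) + 4 * n * ρ * shapeDiag n c ρ i) := by
  ext k i
  have h : (fun r => shapeA n c r k i) =ᶠ[nhds ρ]
      fun r => if k = i then shapeDiag n c r k else 0 := by
    filter_upwards [lt_mem_nhds hρ] with r hr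
    rw [shapeA_eq hc hr, Matrix.diagonal_apply]
  rw [shapeADeriv, Matrix.of_apply, h.deriv_eq, Matrix.diagonal_apply]
  split_ifs
  · exact (hasDerivAt_shapeDiag hc hρ k).deriv
  · exact deriv_const _ _

end OneLoop

theorem mainTheorem2 (n : ℕ) (hn : 1 ≤ n) (c ρ : ℝ) (hc : 0 ≤ c) (hρ : 0 < ρ) :
    (∀ u v : Coord n → ℝ,
      ricciTensor (fiberGram n c ρ) 0 u v =
        -2 * ((n : ℝ) + 2) * fiberMetric c ρ 0 u v
          - 2 * (n : ℝ) * ρ * deriv (fun r => fiberMetric c r 0 u v) ρ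
          + 1 / lapse c ρ * fiberMetric c ρ 0 (shapeADeriv n c ρ *ᵥ u) v) ∧
    shapeA n c ρ = Matrix.diagonal (fun i => -(1 / (2 * ρ)) *
      blockVec n (c / (ρ + c))
        ((2 * ρ ^ 2 + 5 * c * ρ + 4 * c ^ 2) / ((ρ + c) * (ρ + 2 * c)))
        ((ρ + 4 * c) / (ρ + 2 * c)) 1 i) ∧
    ricciEndo (fiberGram n c ρ) 0 =
      Matrix.diagonal (blockVec n (r₁ n c ρ) (r₂ n c ρ) (r₃ n c ρ) (r₄ c ρ)) ∧
    (ricciEndo (fiberGram n c ρ) 0).charpoly =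
      (Polynomial.X - Polynomial.C (r₁ n c ρ)) ^ (2 * n - 2)
        * (Polynomial.X - Polynomial.C (r₂ n c ρ))
        * (Polynomial.X - Polynomial.C (r₃ n c ρ)) ^ 2
        * (Polynomial.X - Polynomial.C (r₄ c ρ)) ^ (2 * n - 2) := by
  refine ⟨fun u v => ?_, shapeA_eq hc hρ, ricciEndo_eq_diagonal hn hc hρ, ?_⟩
  · have hf : lapse c ρ ≠ 0 := by
      rw [lapse]
      positivity
    rw [ricciTensor, ricciMatrix_eq_diagonal hn hc hρ, shapeADeriv_eq hc hρ,
      (hasDerivAt_fiberMetric_zero hc hρ u v).deriv, fiberMetric_zero hc hρ, fiberMetric_zero hc hρ,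
      dotProduct, Finset.mul_sum, Finset.mul_sum, Finset.mul_sum, ← Finset.sum_sub_distrib,
      ← Finset.sum_add_distrib]
    refine Finset.sum_congr rfl fun i _ => ?_
    rw [Matrix.mulVec_diagonal, Matrix.mulVec_diagonal]
    field_simp
    ring
  · rw [ricciEndo_eq_diagonal hn hc hρ, charpoly_diagonal_blockVec hn]
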